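/- Let $1\le k<k'\le n-1$ be integers. Let $G_{n,k}$ be the Grassmann manifold of all $k$-dimensional linear subspaces of $\mathbb{R}^n$ with its $O(n)$-invariant probability measure $d\xi$, and let $G(n,k)$ be the set of all $k$-dimensional affine planes in $\mathbb{R}^n$; each such plane is written as $\tau(\xi,u)=\xi+u$ with $\xi\in G_{n,k}$, $u\in\xi^\perp$. For $\eta\in G_{n,k'}$ let $d_\eta\xi$ be the $O(\eta)$-invariant probability measure on the set of all $k$-dimensional linear subspaces $\xi\subset\eta$. A function $f:G(n,k)\to\mathbb{C}$ is called quasi-radial if $f(\xi,u)=f_0(\xi,|u|)$ for some function $f_0$ and all $\xi\in G_{n,k}$, $u\in\xi^\perp$; quasi-radial functions on $G(n,k')$ are defined in the same way. The Radon transform of $f$ is the function on $G(n,k')$ given by $$(Rf)(\eta,v)=\int_{\xi\subset\eta}d_\eta\xi\int_{\xi^\perp\cap\eta}f(\xi,v+x)\,dx,\qquad \eta\in G_{n,k'},\ v\in\eta^\perp .$$ Let $f(\xi,u)=f_0(\xi,|u|)$ be a quasi-radial function on $G(n,k)$, with $f_0$ measurable on $G_{n,k}\times(0,\infty)$, such that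 $$\int_{G_{n,k}}d\xi\int_a^\infty|f_0(\xi,r)|\,r^{k'-k-1}\,dr<\infty\qquad\text{for all } a>0 .$$ Then the integral $(Rf)(\eta,v)$ exists in the Lebesgue sense (that is, it is finite when $f$ is replaced by $|f|$) for almost all $\eta\in G_{n,k'}$ and almost all $v\in\eta^\perp$, and $\varphi=Rf$ is quasi-radial. Moreover, if $\varphi(\eta,v)=\varphi_0(\eta,|v|)$, then $$\varphi_0(\eta,s)=\int_{\xi\subset\eta}g_\xi(s)\,d_\eta\xi,\qquad g_\xi(s)=\sigma_{k'-k-1}\int_s^\infty f_0(\xi,r)\,(r^2-s^2)^{(k'-k)/2-1}\,r\,dr,$$ where $\sigma_{d-1}=2\pi^{d/2}/\Gamma(d/2)$ is the area of the unit sphere in $\mathbb{R}^d$; for every $\eta\in G_{n,k'}$ and $v\in\eta^\perp$, the iterated integral on the right-hand side with $s=|v|$ exists in the Lebesgue sense if and only if $(Rf)(\eta,v)$ does. (Where an integral does not exist in the Lebesgue sense, it is assigned the value $0$, the inner integrals being treated first; with this convention the formula holds for all $\eta\in G_{n,k'}$ and $s\ge0$.) -/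

import Mathlib

open MeasureTheory Set
open scoped ENNReal

noncomputable section

/-! ### The Grassmannian of `k`-dimensional linear subspaces -/

/-- The set of all `k`-dimensional linear subspaces of the Euclidean space `V`. -/
def Gr (V : Type*) [NormedAddCommGroup V] [InnerProductSpace ℝ V] (k : ℕ) : Type _ :=
  {ξ : Submodule ℝ V // Module.finrank ℝ ξ = k}

namespace Gr

/-- The usual topology of the Grassmannian: subspaces are identified with the orthogonal
projections onto them. -/
instance topologicalSpace (V : Type*) [NormedAddCommGroup V] [InnerProductSpace ℝ V]
    [FiniteDimensional ℝ V] (k : ℕ) : TopologicalSpace (Gr V k) :=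
  TopologicalSpace.induced (fun ξ => (ξ.1.starProjection : V →L[ℝ] V)) inferInstance

instance measurableSpace (V : Type*) [NormedAddCommGroup V] [InnerProductSpace ℝ V]
    [FiniteDimensional ℝ V] (k : ℕ) : MeasurableSpace (Gr V k) := borel _

instance borelSpace (V : Type*) [NormedAddCommGroup V] [InnerProductSpace ℝ V]
    [FiniteDimensional ℝ V] (k : ℕ) : BorelSpace (Gr V k) := ⟨rfl⟩

/-- The image of a `k`-dimensional subspace under a linear isometry. -/
def map {V W : Type*} [NormedAddCommGroup V] [InnerProductSpace ℝ V] [NormedAddCommGroup W]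
    [InnerProductSpace ℝ W] {k : ℕ} (L : V →ₗᵢ[ℝ] W) (ξ : Gr V k) : Gr W k :=
  ⟨ξ.1.map L.toLinearMap,
    (Submodule.equivMapOfInjective L.toLinearMap L.injective ξ.1).finrank_eq.symm.trans ξ.2⟩

end Gr

/-- The orthogonal group `O(V)`. -/
abbrev OrthGroup (V : Type*) [NormedAddCommGroup V] [InnerProductSpace ℝ V]
    [FiniteDimensional ℝ V] : Type _ := unitary (V →L[ℝ] V)

instance OrthGroup.compactSpace (V : Type*) [NormedAddCommGroup V] [InnerProductSpace ℝ V]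
    [FiniteDimensional ℝ V] : CompactSpace (OrthGroup V) := by
  refine isCompact_iff_compactSpace.mp ?_
  have : ProperSpace (V →L[ℝ] V) := FiniteDimensional.proper_real _
  refine Metric.isCompact_of_isClosed_isBounded isClosed_unitary ?_
  refine (Metric.isBounded_closedBall (x := (0 : V →L[ℝ] V)) (r := 1)).subset ?_
  intro u hu
  rw [mem_closedBall_zero_iff]
  refine ContinuousLinearMap.opNorm_le_bound _ zero_le_one fun x => ?_
  rw [one_mul]
  exact (Unitary.norm_map ⟨u, hu⟩ x).le

/-- The Haar probability measure of `O(V)`. -/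
def orthHaar (V : Type*) [NormedAddCommGroup V] [InnerProductSpace ℝ V] [FiniteDimensional ℝ V] :
    Measure (OrthGroup V) := Measure.haarMeasure ⊤

open Classical in
/-- The `O(V)`-invariant probability measure `dξ` on the Grassmannian of `k`-dimensional subspaces
of `V`, `k ≤ dim V`: the law of `g ξ₀`, where `g` is distributed over `O(V)` by the Haar probability
measure and `ξ₀` is a fixed `k`-dimensional subspace (the choice of `ξ₀` does not matter, as `O(V)`
acts transitively). For `k > dim V` the Grassmannian is empty. -/
def grMeasure (V : Type*) [NormedAddCommGroup V] [InnerProductSpace ℝ V] [FiniteDimensional ℝ V]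
    (k : ℕ) : Measure (Gr V k) :=
  if h : Nonempty (Gr V k) then
    (orthHaar V).map fun g => Gr.map (Unitary.linearIsometryEquiv g).toLinearIsometry h.some
  else 0

/-- The canonical probability measure `d_η ξ` on the set of all `k`-dimensional subspaces `ξ ⊂ η`,
as a measure on the Grassmannian of `V` that lives on these subspaces: the image of the
`O(η)`-invariant probability measure on the Grassmannian of `η`. -/
def subGrMeasure {V : Type*} [NormedAddCommGroup V] [InnerProductSpace ℝ V] [FiniteDimensional ℝ V]
    {m : ℕ} (k : ℕ) (η : Gr V m) : Measure (Gr V k) :=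
  (grMeasure η.1 k).map (Gr.map η.1.subtypeₗᵢ)

/-! ### The affine Grassmannian -/

/-- The set of all `k`-dimensional affine planes in `V`. -/
def AffGr (V : Type*) [NormedAddCommGroup V] [InnerProductSpace ℝ V] (k : ℕ) : Type _ :=
  {τ : AffineSubspace ℝ V // (τ : Set V).Nonempty ∧ Module.finrank ℝ τ.direction = k}

namespace AffGr

/-- The plane `τ(ξ, u) = ξ + u`. -/
def mk {V : Type*} [NormedAddCommGroup V] [InnerProductSpace ℝ V] {k : ℕ}
    (ξ : Gr V k) (u : V) : AffGr V k :=
  ⟨AffineSubspace.mk' u ξ.1, AffineSubspace.mk'_nonempty u ξ.1, by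
    rw [AffineSubspace.direction_mk']
    exact ξ.2⟩

/-- The linear subspace `ξ` parallel to the plane `τ = ξ + u`. -/
def dir {V : Type*} [NormedAddCommGroup V] [InnerProductSpace ℝ V] {k : ℕ}
    (τ : AffGr V k) : Gr V k := ⟨τ.1.direction, τ.2.2⟩

/-- The point `u ∈ ξ^⊥` of the plane `τ = ξ + u`, that is, its point nearest to the origin. -/
def foot {V : Type*} [NormedAddCommGroup V] [InnerProductSpace ℝ V] [FiniteDimensional ℝ V] {k : ℕ}
    (τ : AffGr V k) : V :=
  haveI : Nonempty τ.1 := τ.2.1.to_subtype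
  (EuclideanGeometry.orthogonalProjection τ.1 (0 : V) : V)

end AffGr

/-- `f(ξ, u) = f₀(ξ, |u|)` for all `k`-dimensional `ξ` and all `u ∈ ξ^⊥`. -/
def HasRadialProfile {V : Type*} [NormedAddCommGroup V] [InnerProductSpace ℝ V] {k : ℕ}
    (f : AffGr V k → ℂ) (f₀ : Gr V k → ℝ → ℂ) : Prop :=
  ∀ ξ : Gr V k, ∀ u ∈ Submodule.orthogonal ξ.1, f (AffGr.mk ξ u) = f₀ ξ ‖u‖

/-- Quasi-radial functions on the affine Grassmannian. -/
def QuasiRadial {V : Type*} [NormedAddCommGroup V] [InnerProductSpace ℝ V] {k : ℕ}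
    (f : AffGr V k → ℂ) : Prop :=
  ∃ f₀ : Gr V k → ℝ → ℂ, HasRadialProfile f f₀

/-! ### The Radon transform -/

/-- The integral `∫ dν(x) ∫ F(x, y) dm_x(y)` exists in the Lebesgue sense, that is, it is finite
when `F` is replaced by `|F|`. -/
def IteratedIntegrable {X : Type*} [MeasurableSpace X] {Y : X → Type*}
    [∀ x, MeasurableSpace (Y x)] (ν : Measure X) (m : ∀ x, Measure (Y x))
    (F : ∀ x, Y x → ℂ) : Prop :=
  (∀ᵐ x ∂ν, Integrable (F x) (m x)) ∧
    Integrable (fun x => ∫ y, ‖F x y‖ ∂(m x)) ν ∧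
    AEStronglyMeasurable (fun x => ∫ y, F x y ∂(m x)) ν

/-- The Radon transform
`(Rf)(η, v) = ∫_{ξ ⊂ η} d_η ξ ∫_{ξ^⊥ ∩ η} f(ξ, v + x) dx`, as a function of the `m`-plane
`ζ = η + v`. -/
def radon {V : Type*} [NormedAddCommGroup V] [InnerProductSpace ℝ V] [FiniteDimensional ℝ V]
    [MeasurableSpace V] [BorelSpace V] {k : ℕ} (m : ℕ) (f : AffGr V k → ℂ) (ζ : AffGr V m) : ℂ :=
  ∫ ξ, (∫ x : ↥(Submodule.orthogonal ξ.1 ⊓ ζ.dir.1), f (AffGr.mk ξ (ζ.foot + (x : V))))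
    ∂(subGrMeasure k ζ.dir)

/-- The integral that defines `(Rf)(ζ)` exists in the Lebesgue sense. -/
def RadonExists {V : Type*} [NormedAddCommGroup V] [InnerProductSpace ℝ V] [FiniteDimensional ℝ V]
    [MeasurableSpace V] [BorelSpace V] {k m : ℕ} (f : AffGr V k → ℂ) (ζ : AffGr V m) : Prop :=
  IteratedIntegrable (subGrMeasure k ζ.dir)
    (fun ξ : Gr V k => (volume : Measure ↥(Submodule.orthogonal ξ.1 ⊓ ζ.dir.1)))
    (fun ξ x => f (AffGr.mk ξ (ζ.foot + (x : V))))

/-- The area `σ_{d-1} = 2 π^{d/2} / Γ(d/2)` of the unit sphere of `ℝᵈ`. -/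
def sphereArea (d : ℕ) : ℝ := 2 * Real.pi ^ ((d : ℝ) / 2) / Real.Gamma ((d : ℝ) / 2)

/-- The integrand `f₀(ξ, r) (r² - s²)^{d/2 - 1} r`. -/
def radialIntegrand {V : Type*} [NormedAddCommGroup V] [InnerProductSpace ℝ V] {k : ℕ}
    (d : ℕ) (f₀ : Gr V k → ℝ → ℂ) (s : ℝ) (ξ : Gr V k) (r : ℝ) : ℂ :=
  f₀ ξ r * (((r ^ 2 - s ^ 2) ^ ((d : ℝ) / 2 - 1) * r : ℝ) : ℂ)

/-- `g_ξ(s) = σ_{d-1} ∫_s^∞ f₀(ξ, r) (r² - s²)^{d/2 - 1} r dr`. -/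
def radialTransform {V : Type*} [NormedAddCommGroup V] [InnerProductSpace ℝ V] {k : ℕ}
    (d : ℕ) (f₀ : Gr V k → ℝ → ℂ) (s : ℝ) (ξ : Gr V k) : ℂ :=
  (sphereArea d : ℂ) * ∫ r in Ioi s, radialIntegrand d f₀ s ξ r

end

/-!
For `ξ ⊂ η`, the integral over `ξ^⊥ ∩ η ≅ ℝ^d`, `d = k' - k`, of the radial function
`x ↦ f₀(ξ, √(|v|² + |x|²))` becomes, in polar coordinates and after the substitution
`r = √(|v|² + |x|²)`, an integral of `f₀(ξ, ·)` over `(|v|, ∞)` against the Abel kernel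
`(r² - |v|²)^{d/2 - 1} r`. This gives the formula for `Rf` and the equivalence of the two notions of
existence, fibre by fibre.

For existence almost everywhere, averaging `d_η ξ` over all `η` gives back `dξ`, by uniqueness of
the `O(n)`-invariant probability measure; hence for almost every `η` the integrability hypothesis
holds with `d_η ξ` in place of `dξ`. The Abel kernel, weighted by `s⁻²` and integrated over
`a < s < r`, is at most `r^{d-1} / a`, so by Tonelli's theorem the Abel integral is finite for
almost every `s > a`. Finally, polar coordinates in `η^⊥ ≠ 0` show that a property of almost every
`s > 0` holds for the norm of almost every `v ∈ η^⊥`.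
-/

/-! ### Invariant measures on homogeneous spaces -/

section Homogeneous

open Measure

theorem isMulRightInvariant_of_isProbabilityMeasure {G : Type*} [TopologicalSpace G] [Group G]
    [IsTopologicalGroup G] [LocallyCompactSpace G] [MeasurableSpace G] [BorelSpace G]
    (μ : Measure G) [μ.IsHaarMeasure] [IsProbabilityMeasure μ] : μ.IsMulRightInvariant where
  map_mul_right_eq_self g := by
    have : IsProbabilityMeasure (μ.map (· * g)) :=
      isProbabilityMeasure_map (measurable_mul_const g).aemeasurable
    exact isHaarMeasure_eq_of_isProbabilityMeasure _ _

variable {G X : Type*} [Group G] [MeasurableSpace G] [MulAction G X] [MeasurableSpace X]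

theorem map_smul_const_eq [MeasurableMul G] [MeasurableSMul G X] [MulAction.IsPretransitive G X]
    (μ : Measure G) [μ.IsMulRightInvariant] (x y : X) : μ.map (· • x) = μ.map (· • y) := by
  obtain ⟨a, rfl⟩ := MulAction.exists_smul_eq G y x
  have h : (fun g : G => g • y) ∘ (· * a) = (· • a • y) := funext fun g => mul_smul g a y
  rw [← h, ← map_map (measurable_smul_const y) (measurable_mul_const a), map_mul_right_eq_self]

theorem smulInvariantMeasure_map_smul_const [MeasurableMul G] [MeasurableSMul G X]
    (μ : Measure G) [μ.IsMulLeftInvariant] (x : X) :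
    SMulInvariantMeasure G X (μ.map (· • x)) :=
  smulInvariantMeasure_map μ _ (fun g h => mul_smul g h x) (measurable_smul_const x)

variable [MeasurableSMul₂ G X]

theorem measurable_map_smul (ν : Measure X) [SFinite ν] :
    Measurable fun g : G => ν.map (g • ·) := by
  refine measurable_of_measurable_coe _ fun s hs => ?_
  simp_rw [map_apply (measurable_const_smul _) hs]
  exact measurable_measure_prodMk_left (measurable_smul hs)

theorem eq_map_smul_const [MeasurableMul G] [MulAction.IsPretransitive G X]
    (μ : Measure G) [IsProbabilityMeasure μ] [μ.IsMulRightInvariant]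
    (ν : Measure X) [IsProbabilityMeasure ν] [SMulInvariantMeasure G X ν] (x : X) :
    ν = μ.map (· • x) := by
  refine ext_of_lintegral _ fun F hF => ?_
  have h_meas : Measurable (Function.uncurry fun (g : G) (y : X) => F (g • y)) :=
    hF.comp measurable_smul
  have h_orbit (y : X) : ∫⁻ g, F (g • y) ∂μ = ∫⁻ z, F z ∂(μ.map (· • x)) := by
    rw [map_smul_const_eq μ x y, lintegral_map hF (measurable_smul_const y)]
  -- Average over the group: `ν` does not change, and every orbit average is the same.
  calc ∫⁻ y, F y ∂ν = ∫⁻ g, ∫⁻ y, F (g • y) ∂ν ∂μ := by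
        simp [(measurePreserving_smul _ ν).lintegral_comp hF]
    _ = ∫⁻ y, ∫⁻ g, F (g • y) ∂μ ∂ν := lintegral_lintegral_swap h_meas.aemeasurable
    _ = ∫⁻ z, F z ∂(μ.map (· • x)) := by simp [h_orbit]

end Homogeneous

open ProbabilityTheory in
theorem ae_integrable_kernel_prod {X Y Z E : Type*} [MeasurableSpace X] [MeasurableSpace Y]
    [MeasurableSpace Z] [NormedAddCommGroup E] {ν : Measure X} {κ : Kernel X Y}
    [IsSFiniteKernel κ] {μ : Measure Z} [SFinite μ] {F : Y × Z → E}
    (hF : Integrable F ((ν.bind κ).prod μ)) : ∀ᵐ x ∂ν, Integrable F ((κ x).prod μ) := by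
  have h_comp : (ν.bind κ).prod μ = ν.bind (Kernel.prod κ (Kernel.const X μ)) := by
    ext s hs
    rw [Measure.prod_apply hs, Measure.bind_apply hs (by fun_prop),
      Measure.lintegral_bind (by fun_prop) (measurable_measure_prodMk_left hs).aemeasurable]
    simp_rw [Kernel.prod_apply' _ _ _ hs, Kernel.const_apply]
  rw [h_comp] at hF
  simpa only [Kernel.prod_apply, Kernel.const_apply] using
    Measure.ae_integrable_of_integrable_comp hF

/-! ### The Grassmannian as a homogeneous space -/

namespace Gr

theorem map_map {U V W : Type*} [NormedAddCommGroup U] [InnerProductSpace ℝ U]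
    [NormedAddCommGroup V] [InnerProductSpace ℝ V] [NormedAddCommGroup W] [InnerProductSpace ℝ W]
    {k : ℕ} (M : V →ₗᵢ[ℝ] W) (L : U →ₗᵢ[ℝ] V) (ξ : Gr U k) :
    map M (map L ξ) = map (M.comp L) ξ :=
  Subtype.ext (Submodule.map_comp L.toLinearMap M.toLinearMap ξ.1).symm

variable {V W : Type*} [NormedAddCommGroup V] [InnerProductSpace ℝ V] [FiniteDimensional ℝ V]
  [NormedAddCommGroup W] [InnerProductSpace ℝ W] [FiniteDimensional ℝ W] {k m : ℕ}

theorem nonempty_iff : Nonempty (Gr V k) ↔ k ≤ Module.finrank ℝ V := by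
  refine ⟨fun ⟨ξ⟩ => ξ.2 ▸ ξ.1.finrank_le, fun h => ?_⟩
  obtain ⟨b, hb⟩ := exists_linearIndependent_of_le_finrank h
  exact ⟨⟨Submodule.span ℝ (range b), by rw [finrank_span_eq_card hb, Fintype.card_fin]⟩⟩

/-- The action `g • ξ = g ξ` of `O(V)` on the Grassmannian. -/
noncomputable instance mulAction : MulAction (OrthGroup V) (Gr V k) where
  smul g ξ := map (Unitary.linearIsometryEquiv g).toLinearIsometry ξ
  one_smul ξ := Subtype.ext (Submodule.map_id ξ.1)
  mul_smul g h ξ := (map_map (Unitary.linearIsometryEquiv g).toLinearIsometry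
    (Unitary.linearIsometryEquiv h).toLinearIsometry ξ).symm

theorem smul_def (g : OrthGroup V) (ξ : Gr V k) :
    g • ξ = map (Unitary.linearIsometryEquiv g).toLinearIsometry ξ := rfl

instance isPretransitive : MulAction.IsPretransitive (OrthGroup V) (Gr V k) where
  exists_smul_eq ξ ζ := by
    let e : ξ.1 ≃ₗᵢ[ℝ] ζ.1 :=
      (stdOrthonormalBasis ℝ ξ.1).equiv (stdOrthonormalBasis ℝ ζ.1)
        (finCongr (ξ.2.trans ζ.2.symm))
    let L : ξ.1 →ₗᵢ[ℝ] V := ζ.1.subtypeₗᵢ.comp e.toLinearIsometry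
    let E : V ≃ₗᵢ[ℝ] V := L.extend.toLinearIsometryEquiv rfl
    have hE (x : ξ.1) : E x = e x := L.extend_apply x
    refine ⟨Unitary.linearIsometryEquiv.symm E, Subtype.ext ?_⟩
    rw [smul_def, MulEquiv.apply_symm_apply]
    refine Submodule.eq_of_le_of_finrank_eq ?_ ?_
    · rintro _ ⟨x, hx, rfl⟩
      exact (hE ⟨x, hx⟩).symm ▸ (e ⟨x, hx⟩).2
    · exact (map E.toLinearIsometry ξ).2.trans ζ.2.symm

theorem isEmbedding_starProjection :
    Topology.IsEmbedding fun ξ : Gr V k => (ξ.1.starProjection : V →L[ℝ] V) :=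
  ⟨⟨rfl⟩, fun _ _ h => Subtype.ext (Submodule.starProjection_inj.1 h)⟩

instance secondCountableTopology : SecondCountableTopology (Gr V k) :=
  isEmbedding_starProjection.secondCountableTopology

instance t2Space : T2Space (Gr V k) :=
  isEmbedding_starProjection.t2Space

theorem starProjection_map (L : V →ₗᵢ[ℝ] W) (ξ : Gr V k) :
    (map L ξ).1.starProjection = L.toContinuousLinearMap ∘L ξ.1.starProjection ∘L
      ContinuousLinearMap.adjoint L.toContinuousLinearMap := by
  ext x
  refine Submodule.eq_starProjection_of_mem_orthogonal
    (Submodule.mem_map_of_mem (Submodule.starProjection_apply_mem _ _)) ?_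
  rw [Submodule.mem_orthogonal]
  rintro _ ⟨y, hy, rfl⟩
  have h := (Submodule.mem_orthogonal _ _).1 (Submodule.sub_starProjection_mem_orthogonal
    (K := ξ.1) (ContinuousLinearMap.adjoint L.toContinuousLinearMap x)) y hy
  rw [inner_sub_right, ContinuousLinearMap.adjoint_inner_right] at h
  simpa [inner_sub_right] using h

theorem continuous_map (L : V →ₗᵢ[ℝ] W) : Continuous (map (k := k) L) := by
  rw [isEmbedding_starProjection.continuous_iff]
  simp only [Function.comp_def, starProjection_map]
  exact continuous_const.clm_comp (isEmbedding_starProjection.continuous.clm_comp continuous_const)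

theorem measurable_map (L : V →ₗᵢ[ℝ] W) : Measurable (map (k := k) L) :=
  (continuous_map L).measurable

instance continuousSMul : ContinuousSMul (OrthGroup V) (Gr V k) where
  continuous_smul := by
    rw [isEmbedding_starProjection.continuous_iff]
    simp only [Function.comp_def, smul_def, starProjection_map]
    have h : Continuous fun p : OrthGroup V × Gr V k => (p.1 : V →L[ℝ] V) := by fun_prop
    exact h.clm_comp ((isEmbedding_starProjection.continuous.comp continuous_snd).clm_comp
      (ContinuousLinearMap.adjoint.continuous.comp h))

theorem isClosed_setOf_le (η : Gr V m) : IsClosed {ξ : Gr V k | ξ.1 ≤ η.1} := by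
  have h_le (ξ : Gr V k) : ξ.1 ≤ η.1 ↔
      η.1.starProjection ∘L ξ.1.starProjection = ξ.1.starProjection := by
    refine ⟨fun h => ?_, fun h x hx => ?_⟩
    · ext x
      exact Submodule.starProjection_eq_self_iff.2 (h (Submodule.starProjection_apply_mem _ _))
    · rw [← Submodule.starProjection_eq_self_iff] at hx ⊢
      simpa [hx] using DFunLike.congr_fun h x
  simp_rw [h_le]
  exact isClosed_eq (continuous_const.clm_comp isEmbedding_starProjection.continuous)
    isEmbedding_starProjection.continuous

end Gr

section InvariantMeasure

variable {V W : Type*} [NormedAddCommGroup V] [InnerProductSpace ℝ V] [FiniteDimensional ℝ V]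
  [NormedAddCommGroup W] [InnerProductSpace ℝ W] [FiniteDimensional ℝ W] {k m : ℕ}

instance orthHaar.isHaarMeasure : (orthHaar V).IsHaarMeasure := by
  unfold orthHaar
  infer_instance

instance orthHaar.isProbabilityMeasure : IsProbabilityMeasure (orthHaar V) where
  measure_univ := Measure.haarMeasure_self (K₀ := ⊤)

instance orthHaar.isMulRightInvariant : (orthHaar V).IsMulRightInvariant :=
  isMulRightInvariant_of_isProbabilityMeasure _

theorem grMeasure_eq_map (ξ : Gr V k) : grMeasure V k = (orthHaar V).map (· • ξ) := by
  rw [grMeasure, dif_pos ⟨ξ⟩]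
  exact map_smul_const_eq _ _ ξ

instance grMeasure.smulInvariantMeasure :
    SMulInvariantMeasure (OrthGroup V) (Gr V k) (grMeasure V k) := by
  rcases isEmpty_or_nonempty (Gr V k) with h | ⟨⟨ξ⟩⟩
  · rw [Measure.eq_zero_of_isEmpty (grMeasure V k)]
    infer_instance
  · rw [grMeasure_eq_map ξ]
    exact smulInvariantMeasure_map_smul_const _ ξ

instance grMeasure.isZeroOrProbabilityMeasure : IsZeroOrProbabilityMeasure (grMeasure V k) := by
  rcases isEmpty_or_nonempty (Gr V k) with h | ⟨⟨ξ⟩⟩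
  · rw [Measure.eq_zero_of_isEmpty (grMeasure V k)]
    infer_instance
  · rw [grMeasure_eq_map ξ]
    infer_instance

theorem isProbabilityMeasure_grMeasure (hk : k ≤ Module.finrank ℝ V) :
    IsProbabilityMeasure (grMeasure V k) := by
  obtain ⟨ξ⟩ := Gr.nonempty_iff.2 hk
  rw [grMeasure_eq_map ξ]
  exact Measure.isProbabilityMeasure_map (measurable_smul_const ξ).aemeasurable

theorem eq_grMeasure {ν : Measure (Gr V k)} [IsProbabilityMeasure ν]
    (hν : ∀ g : OrthGroup V, ν.map (g • ·) = ν) : ν = grMeasure V k := by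
  have : SMulInvariantMeasure (OrthGroup V) (Gr V k) ν :=
    ((smulInvariantMeasure_tfae (OrthGroup V) ν).out 0 5).2 hν
  obtain ⟨ξ⟩ := nonempty_of_isProbabilityMeasure ν
  rw [grMeasure_eq_map ξ]
  exact eq_map_smul_const _ ν ξ

theorem map_grMeasure (e : V ≃ₗᵢ[ℝ] W) :
    (grMeasure V k).map (Gr.map e.toLinearIsometry) = grMeasure W k := by
  rcases isEmpty_or_nonempty (Gr W k) with h | ⟨⟨ξ⟩⟩
  · exact Subsingleton.elim _ _
  have := isProbabilityMeasure_grMeasure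
    (e.toLinearEquiv.finrank_eq.symm ▸ Gr.nonempty_iff.1 ⟨ξ⟩ : k ≤ Module.finrank ℝ V)
  have : IsProbabilityMeasure ((grMeasure V k).map (Gr.map e.toLinearIsometry)) :=
    Measure.isProbabilityMeasure_map (Gr.measurable_map _).aemeasurable
  refine eq_grMeasure fun g => ?_
  let h : OrthGroup V := Unitary.linearIsometryEquiv.symm
    ((e.trans (Unitary.linearIsometryEquiv g)).trans e.symm)
  have h_comm : (g • ·) ∘ Gr.map e.toLinearIsometry =
      Gr.map (k := k) e.toLinearIsometry ∘ (h • ·) := by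
    funext ζ
    simp only [Function.comp_apply, Gr.smul_def, Gr.map_map, h, MulEquiv.apply_symm_apply]
    congr 1
    ext x
    simp
  rw [Measure.map_map (measurable_const_smul g) (Gr.measurable_map _), h_comm,
    ← Measure.map_map (Gr.measurable_map _) (measurable_const_smul h), MeasureTheory.map_smul]

instance subGrMeasure.isZeroOrProbabilityMeasure (η : Gr V m) :
    IsZeroOrProbabilityMeasure (subGrMeasure k η) := by
  unfold subGrMeasure
  infer_instance

theorem isProbabilityMeasure_subGrMeasure (hkm : k ≤ m) (η : Gr V m) :
    IsProbabilityMeasure (subGrMeasure k η) := by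
  have := isProbabilityMeasure_grMeasure (hkm.trans_eq η.2.symm)
  exact Measure.isProbabilityMeasure_map (Gr.measurable_map _).aemeasurable

theorem subGrMeasure_smul (g : OrthGroup V) (η : Gr V m) :
    subGrMeasure k (g • η) = (subGrMeasure k η).map (g • ·) := by
  let e : η.1 ≃ₗᵢ[ℝ] (g • η).1 := (Unitary.linearIsometryEquiv g).submoduleMap η.1
  have h_comm : Gr.map (g • η).1.subtypeₗᵢ ∘ Gr.map (k := k) e.toLinearIsometry =
      (g • ·) ∘ Gr.map η.1.subtypeₗᵢ := by
    funext ζ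
    simp only [Function.comp_apply, Gr.smul_def, Gr.map_map]
    rfl
  rw [subGrMeasure, ← map_grMeasure e, subGrMeasure,
    Measure.map_map (Gr.measurable_map _) (Gr.measurable_map _), h_comm,
    Measure.map_map (measurable_const_smul g) (Gr.measurable_map _)]

theorem ae_le_subGrMeasure (η : Gr V m) : ∀ᵐ ξ ∂(subGrMeasure k η), ξ.1 ≤ η.1 := by
  rw [subGrMeasure, ae_map_iff (Gr.measurable_map _).aemeasurable
    (Gr.isClosed_setOf_le η).measurableSet]
  exact .of_forall fun ζ => Submodule.map_subtype_le η.1 ζ.1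

theorem measurable_subGrMeasure : Measurable (subGrMeasure k : Gr V m → Measure (Gr V k)) := by
  rcases isEmpty_or_nonempty (Gr V m) with h | ⟨⟨η⟩⟩
  · exact measurable_of_empty _
  -- A map on `Gr V m` is measurable as soon as its composition with an orbit map of the Polish
  -- group `O(V)` is.
  rw [← Measurable.measurable_comp_iff_of_surjective (measurable_smul_const η)
    (MulAction.surjective_smul (OrthGroup V) η)]
  simpa only [Function.comp_def, subGrMeasure_smul] using measurable_map_smul (subGrMeasure k η)

/-- The measures `d_η ξ` as a kernel `η ↦ d_η ξ`, which is Markov for `k ≤ m`. -/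
noncomputable def subGrKernel (V : Type*) [NormedAddCommGroup V] [InnerProductSpace ℝ V]
    [FiniteDimensional ℝ V] (k m : ℕ) : ProbabilityTheory.Kernel (Gr V m) (Gr V k) where
  toFun := subGrMeasure k
  measurable' := measurable_subGrMeasure

theorem subGrKernel_apply (η : Gr V m) : subGrKernel V k m η = subGrMeasure k η := rfl

instance subGrKernel.isFiniteKernel :
    ProbabilityTheory.IsFiniteKernel (subGrKernel V k m) where
  exists_univ_le := ⟨1, ENNReal.one_lt_top, fun η => by
    rw [subGrKernel_apply]
    exact prob_le_one⟩

theorem grMeasure_bind_subGrKernel (hkm : k ≤ m) (hm : m ≤ Module.finrank ℝ V) :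
    (grMeasure V m).bind (subGrKernel V k m) = grMeasure V k := by
  have := isProbabilityMeasure_grMeasure hm
  have : ProbabilityTheory.IsMarkovKernel (subGrKernel V k m) :=
    ⟨isProbabilityMeasure_subGrMeasure hkm⟩
  refine eq_grMeasure fun g => ?_
  conv_rhs => rw [← MeasureTheory.map_smul g (grMeasure V m)]
  ext s hs
  rw [Measure.map_apply (measurable_const_smul g) hs,
    Measure.bind_apply (measurable_const_smul g hs) (by fun_prop),
    Measure.bind_apply hs (by fun_prop),
    lintegral_map ((subGrKernel V k m).measurable_coe hs) (measurable_const_smul g)]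
  simp_rw [subGrKernel_apply, subGrMeasure_smul, Measure.map_apply (measurable_const_smul g) hs]

theorem ae_integrable_subGrMeasure_prod {Y E : Type*} [MeasurableSpace Y] [NormedAddCommGroup E]
    {μ : Measure Y} [SFinite μ] {F : Gr V k × Y → E} (hkm : k ≤ m) (hm : m ≤ Module.finrank ℝ V)
    (hF : Integrable F ((grMeasure V k).prod μ)) :
    ∀ᵐ η ∂(grMeasure V m), Integrable F ((subGrMeasure k η).prod μ) :=
  ae_integrable_kernel_prod (κ := subGrKernel V k m) (by rwa [grMeasure_bind_subGrKernel hkm hm])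

end InvariantMeasure

/-! ### Radial integrals and the Abel kernel -/

/-- The kernel `(r² - s²)^{d/2 - 1} r` of the Abel-type integral into which the substitution
`r = √(s² + |x|²)` turns an integral over `x ∈ ℝᵈ`. -/
noncomputable def abelKernel (d : ℕ) (s r : ℝ) : ℝ := (r ^ 2 - s ^ 2) ^ ((d : ℝ) / 2 - 1) * r

section AbelKernel

variable {d : ℕ} {s r : ℝ}

theorem sq_sub_sq_pos (hs : 0 ≤ s) (hr : s < r) : 0 < r ^ 2 - s ^ 2 :=
  sub_pos.2 (pow_lt_pow_left₀ hr hs two_ne_zero)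

theorem bijOn_sqrt_sq_sub_sq (hs : 0 ≤ s) :
    BijOn (fun r => √(r ^ 2 - s ^ 2)) (Ioi s) (Ioi 0) := by
  refine InvOn.bijOn (f' := fun ρ => √(s ^ 2 + ρ ^ 2)) ⟨fun r hr => ?_, fun ρ hρ => ?_⟩
    (fun r hr => Real.sqrt_pos.2 (sq_sub_sq_pos hs hr))
    (fun ρ hρ => Real.lt_sqrt_of_sq_lt (lt_add_of_pos_right _ (pow_pos hρ 2)))
  · simp only
    rw [Real.sq_sqrt (sq_sub_sq_pos hs hr).le, add_sub_cancel, Real.sqrt_sq (hs.trans hr.le)]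
  · simp only
    rw [Real.sq_sqrt (by positivity), add_sub_cancel_left, Real.sqrt_sq hρ.le]

theorem hasDerivAt_sqrt_sq_sub_sq (h : r ^ 2 - s ^ 2 ≠ 0) :
    HasDerivAt (fun r => √(r ^ 2 - s ^ 2)) (r / √(r ^ 2 - s ^ 2)) r := by
  convert ((hasDerivAt_pow 2 r).sub_const (s ^ 2)).sqrt h using 1
  push_cast
  ring

theorem measurable_abelKernel (d : ℕ) : Measurable (Function.uncurry (abelKernel d)) := by
  unfold abelKernel Function.uncurry
  fun_prop

theorem abelKernel_nonneg (d : ℕ) (hs : 0 ≤ s) (hr : s < r) : 0 ≤ abelKernel d s r :=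
  mul_nonneg (Real.rpow_nonneg (sq_sub_sq_pos hs hr).le _) (hs.trans hr.le)

theorem abelKernel_eq_sqrt (hd : d ≠ 0) (h : 0 < r ^ 2 - s ^ 2) :
    abelKernel d s r = √(r ^ 2 - s ^ 2) ^ (d - 1) * (r / √(r ^ 2 - s ^ 2)) := by
  have h_exp : (d : ℝ) / 2 - 1 = 1 / 2 * ↑(d - 1) - 1 / 2 := by
    rw [Nat.cast_sub (Nat.one_le_iff_ne_zero.2 hd)]
    push_cast
    ring
  rw [abelKernel, h_exp, Real.rpow_sub h, Real.rpow_mul_natCast h.le, ← Real.sqrt_eq_rpow]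
  ring

theorem abelKernel_smul_eq {F : Type*} [NormedAddCommGroup F] [NormedSpace ℝ F] (hd : d ≠ 0)
    (hs : 0 ≤ s) (hr : s < r) (h : ℝ → F) :
    |r / √(r ^ 2 - s ^ 2)| • (√(r ^ 2 - s ^ 2) ^ (d - 1) • h √(s ^ 2 + √(r ^ 2 - s ^ 2) ^ 2)) =
      abelKernel d s r • h r := by
  have hr0 : 0 < r := hs.trans_lt hr
  have h_pos := sq_sub_sq_pos hs hr
  rw [Real.sq_sqrt h_pos.le, add_sub_cancel, Real.sqrt_sq hr0.le, smul_smul,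
    abs_of_nonneg (by positivity), abelKernel_eq_sqrt hd h_pos, mul_comm]

end AbelKernel

theorem sphereArea_pos {d : ℕ} (hd : d ≠ 0) : 0 < sphereArea d := by
  have := Real.Gamma_pos_of_pos (show 0 < (d : ℝ) / 2 by positivity)
  have := Real.pi_pos
  unfold sphereArea
  positivity

theorem map_norm_absolutelyContinuous {E : Type*} [NormedAddCommGroup E] [NormedSpace ℝ E]
    [FiniteDimensional ℝ E] [Nontrivial E] [MeasurableSpace E] [BorelSpace E] (μ : Measure E)
    [μ.IsAddHaarMeasure] : μ.map norm ≪ volume.restrict (Ioi (0 : ℝ)) := by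
  refine Measure.AbsolutelyContinuous.mk fun N hN h_null => ?_
  have h_zero : (fun ρ : ℝ => ρ ^ (Module.finrank ℝ E - 1) • N.indicator (1 : ℝ → ℝ) ρ)
      =ᵐ[volume.restrict (Ioi 0)] 0 := by
    filter_upwards [measure_eq_zero_iff_ae_notMem.1 h_null] with ρ hρ
    simp [hρ]
  have h_int : Integrable (fun x => N.indicator (1 : ℝ → ℝ) ‖x‖) μ := by
    rw [integrable_fun_norm_addHaar μ]
    exact (integrable_zero _ _ _).congr h_zero.symm
  have h_integral : ∫ x, N.indicator (1 : ℝ → ℝ) ‖x‖ ∂μ = 0 := by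
    rw [integral_fun_norm_addHaar, integral_congr_ae h_zero]
    simp
  rw [Measure.map_apply measurable_norm hN, measure_eq_zero_iff_ae_notMem]
  rw [integral_eq_zero_iff_of_nonneg (fun x => indicator_nonneg (by simp) _) h_int] at h_integral
  filter_upwards [h_integral] with x hx
  simpa [indicator_apply] using hx

section Radial

variable {E F : Type*} [NormedAddCommGroup E] [InnerProductSpace ℝ E] [FiniteDimensional ℝ E]
  [MeasurableSpace E] [BorelSpace E] [Nontrivial E] [NormedAddCommGroup F] [NormedSpace ℝ F]

theorem finrank_mul_volume_ball_eq_sphereArea :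
    (Module.finrank ℝ E : ℝ) * (volume : Measure E).real (Metric.ball 0 1) =
      sphereArea (Module.finrank ℝ E) := by
  have hd : (0 : ℝ) < Module.finrank ℝ E := by exact_mod_cast Module.finrank_pos
  have := Real.Gamma_pos_of_pos (half_pos hd)
  rw [Measure.real, InnerProductSpace.volume_ball, ENNReal.ofReal_one, one_pow, one_mul,
    ENNReal.toReal_ofReal (by positivity), Real.Gamma_add_one (by positivity), sphereArea,
    Real.sqrt_eq_rpow, ← Real.rpow_mul_natCast Real.pi_pos.le, one_div_mul_eq_div]
  field_simp

theorem integrable_sqrt_sq_add_norm_sq_iff (h : ℝ → F) {s : ℝ} (hs : 0 ≤ s) :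
    Integrable (fun x : E => h √(s ^ 2 + ‖x‖ ^ 2)) ↔
      IntegrableOn (fun r => abelKernel (Module.finrank ℝ E) s r • h r) (Ioi s) := by
  rw [integrable_fun_norm_addHaar volume (f := fun ρ => h √(s ^ 2 + ρ ^ 2)),
    ← (bijOn_sqrt_sq_sub_sq hs).image_eq,
    integrableOn_image_iff_integrableOn_abs_deriv_smul measurableSet_Ioi
      (fun r hr => (hasDerivAt_sqrt_sq_sub_sq (sq_sub_sq_pos hs hr).ne').hasDerivWithinAt)
      (bijOn_sqrt_sq_sub_sq hs).injOn]
  exact integrableOn_congr_fun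
    (fun r hr => abelKernel_smul_eq Module.finrank_pos.ne' hs hr h) measurableSet_Ioi

theorem integral_sqrt_sq_add_norm_sq (h : ℝ → F) {s : ℝ} (hs : 0 ≤ s) :
    ∫ x : E, h √(s ^ 2 + ‖x‖ ^ 2) = sphereArea (Module.finrank ℝ E) •
      ∫ r in Ioi s, abelKernel (Module.finrank ℝ E) s r • h r := by
  rw [integral_fun_norm_addHaar volume (fun ρ => h √(s ^ 2 + ρ ^ 2)), ← Nat.cast_smul_eq_nsmul ℝ,
    smul_smul, finrank_mul_volume_ball_eq_sphereArea, ← (bijOn_sqrt_sq_sub_sq hs).image_eq,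
    integral_image_eq_integral_abs_deriv_smul measurableSet_Ioi
      (fun r hr => (hasDerivAt_sqrt_sq_sub_sq (sq_sub_sq_pos hs hr).ne').hasDerivWithinAt)
      (bijOn_sqrt_sq_sub_sq hs).injOn]
  congr 1
  exact setIntegral_congr_fun measurableSet_Ioi
    fun r hr => abelKernel_smul_eq Module.finrank_pos.ne' hs hr h

end Radial

/-! ### Abel integrals exist almost everywhere -/

section AbelKernelEstimate

variable {d : ℕ} {a s r : ℝ}

theorem abelKernel_le (hd : d ≠ 0) (hs : 0 ≤ s) (hr : s < r) :
    abelKernel d s r ≤ r ^ (d - 1) * (r / √(r ^ 2 - s ^ 2)) := by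
  have hr0 : 0 < r := hs.trans_lt hr
  rw [abelKernel_eq_sqrt hd (sq_sub_sq_pos hs hr)]
  gcongr
  exact Real.sqrt_le_iff.2 ⟨hr0.le, sub_le_self _ (sq_nonneg s)⟩

theorem hasDerivAt_neg_sqrt_sq_sub_sq_div (hs : 0 < s) (hr : s < r) :
    HasDerivAt (fun s => -(√(r ^ 2 - s ^ 2) / (r * s))) (r / √(r ^ 2 - s ^ 2) / s ^ 2) s := by
  have hr0 : 0 < r := hs.trans hr
  have h_pos := sq_sub_sq_pos hs.le hr
  have := Real.sqrt_pos.2 h_pos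
  refine ((((hasDerivAt_pow 2 s).const_sub (r ^ 2)).sqrt h_pos.ne').fun_div
    (hasDerivAt_const_mul r) (by positivity)).fun_neg.congr_deriv ?_
  push_cast
  field_simp
  rw [Real.sq_sqrt h_pos.le]
  ring

theorem setLIntegral_div_sqrt_sq_sub_sq_le (ha : 0 < a) (hr : a < r) :
    ∫⁻ s in Ioo a r, ENNReal.ofReal (r / √(r ^ 2 - s ^ 2) / s ^ 2) ≤ ENNReal.ofReal (1 / a) := by
  have hr0 : 0 < r := ha.trans hr
  have h_cont : ContinuousOn (fun s => -(√(r ^ 2 - s ^ 2) / (r * s))) (Icc a r) :=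
    (ContinuousOn.div (by fun_prop) (by fun_prop)
      fun s hs => (mul_pos hr0 (ha.trans_le hs.1)).ne').neg
  have h_deriv := fun s (hs : s ∈ Ioo a r) =>
    hasDerivAt_neg_sqrt_sq_sub_sq_div (ha.trans hs.1) hs.2
  have h_int := intervalIntegral.integrableOn_deriv_of_nonneg h_cont h_deriv
    fun _ _ => by positivity
  rw [Measure.restrict_congr_set Ioo_ae_eq_Ioc, ← ofReal_integral_eq_lintegral_ofReal h_int
    (.of_forall fun s => by positivity), ← intervalIntegral.integral_of_le hr.le,
    intervalIntegral.integral_eq_sub_of_hasDerivAt_of_le hr.le h_cont h_deriv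
      ((intervalIntegrable_iff_integrableOn_Ioc_of_le hr.le).2 h_int)]
  apply ENNReal.ofReal_le_ofReal
  rw [sub_self, Real.sqrt_zero, zero_div, neg_zero, zero_sub, neg_neg, ← div_div]
  gcongr
  exact div_le_one_of_le₀ (Real.sqrt_le_iff.2 ⟨hr0.le, sub_le_self _ (sq_nonneg a)⟩) hr0.le

theorem setLIntegral_abelKernel_div_sq_le (hd : d ≠ 0) (ha : 0 < a) (hr : a < r) :
    ∫⁻ s in Ioo a r, ENNReal.ofReal (abelKernel d s r / s ^ 2) ≤
      ENNReal.ofReal (r ^ (d - 1) / a) := by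
  have h_pow : 0 ≤ r ^ (d - 1) := pow_nonneg (ha.trans hr).le _
  calc ∫⁻ s in Ioo a r, ENNReal.ofReal (abelKernel d s r / s ^ 2)
      ≤ ∫⁻ s in Ioo a r, ENNReal.ofReal (r ^ (d - 1)) *
          ENNReal.ofReal (r / √(r ^ 2 - s ^ 2) / s ^ 2) := by
        refine setLIntegral_mono' measurableSet_Ioo fun s hs => ?_
        rw [← ENNReal.ofReal_mul h_pow, ← mul_div_assoc]
        gcongr
        exact abelKernel_le hd (ha.trans hs.1).le hs.2
    _ ≤ ENNReal.ofReal (r ^ (d - 1)) * ENNReal.ofReal (1 / a) := by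
        rw [lintegral_const_mul' _ _ ENNReal.ofReal_ne_top]
        gcongr
        exact setLIntegral_div_sqrt_sq_sub_sq_le ha hr
    _ = ENNReal.ofReal (r ^ (d - 1) / a) := by rw [← ENNReal.ofReal_mul h_pow, mul_one_div]

end AbelKernelEstimate

theorem measurable_setLIntegral_Ioi (ν : Measure ℝ) [SFinite ν] {f : ℝ → ℝ → ℝ≥0∞}
    (hf : Measurable (Function.uncurry f)) : Measurable fun s => ∫⁻ r in Ioi s, f s r ∂ν := by
  simp_rw [← lintegral_indicator measurableSet_Ioi]
  exact (hf.indicator (measurableSet_lt measurable_fst measurable_snd)).lintegral_prod_right'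

theorem setLIntegral_setLIntegral_Ioi_swap (μ ν : Measure ℝ) [SFinite μ] [SFinite ν]
    {f : ℝ → ℝ → ℝ≥0∞} (hf : Measurable (Function.uncurry f)) (a : ℝ) :
    ∫⁻ s in Ioi a, ∫⁻ r in Ioi s, f s r ∂ν ∂μ = ∫⁻ r in Ioi a, ∫⁻ s in Ioo a r, f s r ∂μ ∂ν :=
  calc ∫⁻ s in Ioi a, ∫⁻ r in Ioi s, f s r ∂ν ∂μ
      = ∫⁻ s in Ioi a, ∫⁻ r in Ioi a, (Ioi s).indicator (f s) r ∂ν ∂μ := by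
        refine setLIntegral_congr_fun measurableSet_Ioi fun s hs => ?_
        rw [setLIntegral_indicator measurableSet_Ioi,
          inter_eq_left.2 (Ioi_subset_Ioi (le_of_lt hs))]
    _ = ∫⁻ r in Ioi a, ∫⁻ s in Ioi a, (Ioi s).indicator (f s) r ∂μ ∂ν :=
        lintegral_lintegral_swap
          (hf.indicator (measurableSet_lt measurable_fst measurable_snd)).aemeasurable
    _ = ∫⁻ r in Ioi a, ∫⁻ s in Ioo a r, f s r ∂μ ∂ν := by
        refine lintegral_congr fun r => ?_
        rw [← Iio_inter_Ioi, ← setLIntegral_indicator measurableSet_Iio]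
        rfl

theorem ae_setLIntegral_abelKernel_lt_top {d : ℕ} (hd : d ≠ 0) {a : ℝ} (ha : 0 < a)
    (ν : Measure ℝ) [SFinite ν] (h : ∫⁻ r in Ioi a, ENNReal.ofReal (r ^ (d - 1)) ∂ν ≠ ∞) :
    ∀ᵐ s ∂volume.restrict (Ioi a), ∫⁻ r in Ioi s, ENNReal.ofReal (abelKernel d s r) ∂ν < ∞ := by
  have h_meas : Measurable
      (Function.uncurry fun s r => ENNReal.ofReal (abelKernel d s r / s ^ 2)) :=
    ((measurable_abelKernel d).div (measurable_fst.pow_const 2)).ennreal_ofReal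
  -- The weight `s⁻²` makes the kernel integrable in `s`; it is finite, so it costs nothing.
  have h_fin : ∫⁻ s in Ioi a, ∫⁻ r in Ioi s, ENNReal.ofReal (abelKernel d s r / s ^ 2) ∂ν ≠ ∞ := by
    rw [setLIntegral_setLIntegral_Ioi_swap _ ν h_meas]
    refine ne_top_of_le_ne_top (ENNReal.mul_ne_top h (ENNReal.inv_ne_top.2
      (ENNReal.ofReal_pos.2 ha).ne')) ((setLIntegral_mono' measurableSet_Ioi
        fun r hr => setLIntegral_abelKernel_div_sq_le hd ha hr).trans_eq ?_)
    simp_rw [ENNReal.ofReal_div_of_pos ha, div_eq_mul_inv]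
    exact lintegral_mul_const _ (by fun_prop)
  filter_upwards [ae_lt_top (measurable_setLIntegral_Ioi ν h_meas) h_fin,
    ae_restrict_mem measurableSet_Ioi] with s hs has
  have h_sq : 0 < s ^ 2 := pow_pos (ha.trans has) 2
  simp_rw [ENNReal.ofReal_div_of_pos h_sq, div_eq_mul_inv] at hs
  rw [lintegral_mul_const _ (measurable_abelKernel d).of_uncurry_left.ennreal_ofReal] at hs
  exact ENNReal.lt_top_of_mul_ne_top_left hs.ne
    (ENNReal.inv_ne_zero.2 ENNReal.ofReal_ne_top)

theorem setLIntegral_map_snd_withDensity {X Y : Type*} [MeasurableSpace X] [MeasurableSpace Y]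
    (ν : Measure X) [SFinite ν] (μ : Measure Y) [SFinite μ] {w : X × Y → ℝ≥0∞}
    (hw : AEMeasurable w (ν.prod μ)) {g : Y → ℝ≥0∞} (hg : Measurable g) {t : Set Y}
    (ht : MeasurableSet t) :
    ∫⁻ y in t, g y ∂((ν.prod μ).withDensity w).map Prod.snd =
      ∫⁻ p, w p * g p.2 ∂ν.prod (μ.restrict t) := by
  rw [setLIntegral_map ht hg measurable_snd]
  refine (setLIntegral_withDensity_eq_lintegral_mul₀ hw
    (hg.comp measurable_snd).aemeasurable (measurable_snd ht)).trans ?_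
  conv_rhs => rw [← ν.restrict_univ, Measure.prod_restrict, univ_prod]
  rfl

theorem ae_integrable_abelKernel_smul {X E : Type*} [MeasurableSpace X] [NormedAddCommGroup E]
    [NormedSpace ℝ E] {d : ℕ} (hd : d ≠ 0) {a : ℝ} (ha : 0 < a) (ν : Measure X) [SFinite ν]
    {F : X × ℝ → E}
    (h : Integrable (fun p => p.2 ^ (d - 1) • F p) (ν.prod (volume.restrict (Ioi a)))) :
    ∀ᵐ s ∂volume.restrict (Ioi a),
      Integrable (fun p => abelKernel d s p.2 • F p) (ν.prod (volume.restrict (Ioi s))) := by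
  have h_mem (s : ℝ) : ∀ᵐ p ∂ν.prod (volume.restrict (Ioi s)), s < p.2 :=
    Measure.quasiMeasurePreserving_snd.ae (ae_restrict_mem measurableSet_Ioi)
  have hF : AEStronglyMeasurable F (ν.prod (volume.restrict (Ioi a))) := by
    refine (AEStronglyMeasurable.smul
      (f := fun p : X × ℝ => (p.2 ^ (d - 1))⁻¹) (by fun_prop) h.1).congr ?_
    filter_upwards [h_mem a] with p hp
    exact inv_smul_smul₀ (pow_pos (ha.trans hp) _).ne' _
  let μ : Measure ℝ := ((ν.prod (volume.restrict (Ioi a))).withDensity fun p => ‖F p‖ₑ).map Prod.snd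
  have h_lintegral : ∀ s ≥ a, ∀ g : ℝ → ℝ, Measurable g → (∀ r > s, 0 ≤ g r) →
      ∫⁻ r in Ioi s, ENNReal.ofReal (g r) ∂μ =
        ∫⁻ p, ‖g p.2 • F p‖ₑ ∂ν.prod (volume.restrict (Ioi s)) := by
    intro s hs g hg hg_nonneg
    rw [setLIntegral_map_snd_withDensity ν _ hF.enorm hg.ennreal_ofReal measurableSet_Ioi,
      Measure.restrict_restrict_of_subset (Ioi_subset_Ioi hs)]
    refine lintegral_congr_ae ?_
    filter_upwards [h_mem s] with p hp
    rw [enorm_smul, Real.enorm_of_nonneg (hg_nonneg _ hp), mul_comm]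
  have h_fin : ∫⁻ r in Ioi a, ENNReal.ofReal (r ^ (d - 1)) ∂μ ≠ ∞ := by
    rw [h_lintegral a le_rfl _ (by fun_prop) fun r hr => pow_nonneg (ha.trans hr).le _]
    exact h.2.ne
  filter_upwards [ae_setLIntegral_abelKernel_lt_top hd ha μ h_fin,
    ae_restrict_mem measurableSet_Ioi] with s hs has
  have h_meas := (measurable_abelKernel d).of_uncurry_left (x := s)
  refine ⟨(h_meas.comp measurable_snd).aestronglyMeasurable.smul (hF.mono_ac ?_), ?_⟩
  · exact Measure.AbsolutelyContinuous.rfl.prod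
      (Measure.restrict_mono_set _ (Ioi_subset_Ioi (le_of_lt has))).absolutelyContinuous
  · rwa [h_lintegral s (le_of_lt has) _ h_meas
      fun r hr => abelKernel_nonneg d (ha.trans has).le hr] at hs

theorem ae_restrict_Ioi_of_forall_lt {α : Type*} [LinearOrder α] [TopologicalSpace α]
    [OrderTopology α] [DenselyOrdered α] [NoMaxOrder α] [FirstCountableTopology α]
    [MeasurableSpace α] {μ : Measure α} {p : α → Prop} {a : α}
    (h : ∀ b > a, ∀ᵐ x ∂μ.restrict (Ioi b), p x) : ∀ᵐ x ∂μ.restrict (Ioi a), p x := by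
  obtain ⟨u, hu_anti, hu_lt, hu_tendsto⟩ := exists_seq_strictAnti_tendsto a
  rw [← (isGLB_of_tendsto_atTop hu_anti.antitone hu_tendsto).iUnion_Ioi_eq, ae_restrict_iUnion_iff]
  exact fun j => h (u j) (hu_lt j)

/-! ### The Radon transform of a quasi-radial function -/

section AffinePlanes

variable {V : Type*} [NormedAddCommGroup V] [InnerProductSpace ℝ V] {k m : ℕ}

theorem AffGr.dir_mk (η : Gr V m) (v : V) : (AffGr.mk η v).dir = η :=
  Subtype.ext (AffineSubspace.direction_mk' v η.1)

theorem norm_add_eq_sqrt_of_mem_orthogonal {K : Submodule ℝ V} {v x : V} (hv : v ∈ Kᗮ)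
    (hx : x ∈ K) : ‖v + x‖ = √(‖v‖ ^ 2 + ‖x‖ ^ 2) := by
  rw [← Real.sqrt_sq (norm_nonneg (v + x)), sq, sq, sq,
    norm_add_sq_eq_norm_sq_add_norm_sq_of_inner_eq_zero v x
      (Submodule.inner_left_of_mem_orthogonal hx hv)]

theorem HasRadialProfile.apply_mk_add {f : AffGr V k → ℂ} {f₀ : Gr V k → ℝ → ℂ}
    (hf : HasRadialProfile f f₀) {ξ : Gr V k} {K : Submodule ℝ V} (h : ξ.1 ≤ K) {v x : V}
    (hv : v ∈ Kᗮ) (hx : x ∈ ξ.1ᗮ ⊓ K) :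
    f (AffGr.mk ξ (v + x)) = f₀ ξ √(‖v‖ ^ 2 + ‖x‖ ^ 2) := by
  rw [hf ξ _ (add_mem (Submodule.orthogonal_le h hv) hx.1),
    norm_add_eq_sqrt_of_mem_orthogonal hv hx.2]

theorem radialIntegrand_eq_smul (d : ℕ) (f₀ : Gr V k → ℝ → ℂ) (s : ℝ) (ξ : Gr V k) :
    radialIntegrand d f₀ s ξ = fun r => abelKernel d s r • f₀ ξ r := by
  ext r
  rw [Complex.real_smul, mul_comm]
  rfl

variable [FiniteDimensional ℝ V]

theorem AffGr.foot_mk (η : Gr V m) {v : V} (hv : v ∈ η.1ᗮ) : (AffGr.mk η v).foot = v := by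
  have : Nonempty (AffGr.mk η v).1 := (AffGr.mk η v).2.1.to_subtype
  refine EuclideanGeometry.coe_orthogonalProjection_eq_iff_mem.2
    ⟨AffineSubspace.self_mem_mk' v η.1, ?_⟩
  rw [show (AffGr.mk η v).1.direction = η.1 from AffineSubspace.direction_mk' v η.1]
  simpa using hv

theorem AffGr.foot_mem_orthogonal (ζ : AffGr V m) : ζ.foot ∈ ζ.dir.1ᗮ := by
  have : Nonempty ζ.1 := ζ.2.1.to_subtype
  rw [← neg_mem_iff, ← zero_sub]
  exact EuclideanGeometry.vsub_orthogonalProjection_mem_direction_orthogonal ζ.1 0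

theorem finrank_orthogonal_inf {ξ : Gr V k} {η : Gr V m} (h : ξ.1 ≤ η.1) :
    Module.finrank ℝ ↥(ξ.1ᗮ ⊓ η.1) = m - k := by
  have h_finrank := Submodule.finrank_add_inf_finrank_orthogonal h
  rw [ξ.2, η.2] at h_finrank
  omega

theorem nontrivial_orthogonal_inf (hkm : k < m) {ξ : Gr V k} {η : Gr V m} (h : ξ.1 ≤ η.1) :
    Nontrivial ↥(ξ.1ᗮ ⊓ η.1) :=
  Module.nontrivial_of_finrank_pos (R := ℝ)
    ((Nat.sub_pos_of_lt hkm).trans_eq (finrank_orthogonal_inf h).symm)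

theorem nontrivial_orthogonal (hm : m < Module.finrank ℝ V) (η : Gr V m) : Nontrivial ↥η.1ᗮ := by
  have h_finrank := Submodule.finrank_add_finrank_orthogonal η.1
  rw [η.2] at h_finrank
  exact Module.nontrivial_of_finrank_pos (R := ℝ) (by omega)

theorem HasRadialProfile.eq_of_nonneg {f : AffGr V k → ℂ} {f₀ f₁ : Gr V k → ℝ → ℂ}
    (hf₀ : HasRadialProfile f f₀) (hf₁ : HasRadialProfile f f₁) (hk : k < Module.finrank ℝ V)
    (ξ : Gr V k) {s : ℝ} (hs : 0 ≤ s) : f₀ ξ s = f₁ ξ s := by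
  have := nontrivial_orthogonal hk ξ
  obtain ⟨u, rfl⟩ := exists_norm_eq ↥ξ.1ᗮ hs
  exact (hf₀ ξ u u.2).symm.trans (hf₁ ξ u u.2)

end AffinePlanes

namespace HasRadialProfile

variable {V : Type*} [NormedAddCommGroup V] [InnerProductSpace ℝ V] [FiniteDimensional ℝ V]
  [MeasurableSpace V] [BorelSpace V] {k m : ℕ} {f : AffGr V k → ℂ} {f₀ : Gr V k → ℝ → ℂ}

section Fiber

variable {ξ : Gr V k} {η : Gr V m} {v : V}

theorem integrable_iff (hf : HasRadialProfile f f₀) (hkm : k < m) (h : ξ.1 ≤ η.1)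
    (hv : v ∈ η.1ᗮ) :
    Integrable (fun x : ↥(ξ.1ᗮ ⊓ η.1) => f (AffGr.mk ξ (v + x))) ↔
      IntegrableOn (radialIntegrand (m - k) f₀ ‖v‖ ξ) (Ioi ‖v‖) := by
  have := nontrivial_orthogonal_inf hkm h
  rw [radialIntegrand_eq_smul, ← finrank_orthogonal_inf h,
    ← integrable_sqrt_sq_add_norm_sq_iff _ (norm_nonneg v)]
  simp only [hf.apply_mk_add h hv (Subtype.prop _), Submodule.coe_norm]

theorem integral_eq (hf : HasRadialProfile f f₀) (hkm : k < m) (h : ξ.1 ≤ η.1)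
    (hv : v ∈ η.1ᗮ) :
    ∫ x : ↥(ξ.1ᗮ ⊓ η.1), f (AffGr.mk ξ (v + x)) = radialTransform (m - k) f₀ ‖v‖ ξ := by
  have := nontrivial_orthogonal_inf hkm h
  rw [radialTransform, radialIntegrand_eq_smul, ← Complex.real_smul, ← finrank_orthogonal_inf h,
    ← integral_sqrt_sq_add_norm_sq _ (norm_nonneg v)]
  simp only [hf.apply_mk_add h hv (Subtype.prop _), Submodule.coe_norm]

theorem integral_norm_eq (hf : HasRadialProfile f f₀) (hkm : k < m) (h : ξ.1 ≤ η.1)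
    (hv : v ∈ η.1ᗮ) :
    ∫ x : ↥(ξ.1ᗮ ⊓ η.1), ‖f (AffGr.mk ξ (v + x))‖ =
      sphereArea (m - k) * ∫ r in Ioi ‖v‖, ‖radialIntegrand (m - k) f₀ ‖v‖ ξ r‖ := by
  have := nontrivial_orthogonal_inf hkm h
  have h_norm : ∀ r ∈ Ioi ‖v‖, ‖radialIntegrand (m - k) f₀ ‖v‖ ξ r‖ =
      abelKernel (m - k) ‖v‖ r • ‖f₀ ξ r‖ := fun r hr => by
    rw [radialIntegrand_eq_smul, norm_smul,
      Real.norm_of_nonneg (abelKernel_nonneg _ (norm_nonneg v) hr), smul_eq_mul]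
  rw [setIntegral_congr_fun measurableSet_Ioi h_norm, ← smul_eq_mul, ← finrank_orthogonal_inf h,
    ← integral_sqrt_sq_add_norm_sq (fun r => ‖f₀ ξ r‖) (norm_nonneg v)]
  simp only [hf.apply_mk_add h hv (Subtype.prop _), Submodule.coe_norm]

end Fiber

theorem radon_eq (hf : HasRadialProfile f f₀) (hkm : k < m) (ζ : AffGr V m) :
    radon m f ζ = ∫ ξ, radialTransform (m - k) f₀ ‖ζ.foot‖ ξ ∂subGrMeasure k ζ.dir :=
  integral_congr_ae <| (ae_le_subGrMeasure ζ.dir).mono fun _ h =>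
    hf.integral_eq hkm h ζ.foot_mem_orthogonal

theorem radon (hf : HasRadialProfile f f₀) (hkm : k < m) :
    HasRadialProfile (radon m f)
      fun η s => ∫ ξ, radialTransform (m - k) f₀ s ξ ∂subGrMeasure k η := fun η v hv => by
  rw [hf.radon_eq hkm, AffGr.dir_mk, AffGr.foot_mk η hv]

theorem radonExists_iff (hf : HasRadialProfile f f₀) (hkm : k < m) (ζ : AffGr V m) :
    RadonExists f ζ ↔ IteratedIntegrable (subGrMeasure k ζ.dir)
      (fun _ => volume.restrict (Ioi ‖ζ.foot‖)) (radialIntegrand (m - k) f₀ ‖ζ.foot‖) := by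
  have h_area : sphereArea (m - k) ≠ 0 := (sphereArea_pos (Nat.sub_ne_zero_of_lt hkm)).ne'
  have h_le := ae_le_subGrMeasure (k := k) ζ.dir
  have h_foot := ζ.foot_mem_orthogonal
  refine and_congr (Filter.eventually_congr ?_) (and_congr ?_ ?_)
  · exact h_le.mono fun ξ h => hf.integrable_iff hkm h h_foot
  · rw [integrable_congr (h_le.mono fun ξ h => hf.integral_norm_eq hkm h h_foot)]
    exact integrable_const_mul_iff h_area.isUnit _
  · rw [aestronglyMeasurable_congr (h_le.mono fun ξ h => hf.integral_eq hkm h h_foot)]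
    exact aestronglyMeasurable_const_smul_iff₀ (Complex.ofReal_ne_zero.2 h_area)

theorem radonExists_mk_iff (hf : HasRadialProfile f f₀) (hkm : k < m) (η : Gr V m) {v : V}
    (hv : v ∈ η.1ᗮ) :
    RadonExists f (AffGr.mk η v) ↔ IteratedIntegrable (subGrMeasure k η)
      (fun _ => volume.restrict (Ioi ‖v‖)) (radialIntegrand (m - k) f₀ ‖v‖) := by
  rw [hf.radonExists_iff hkm, AffGr.dir_mk, AffGr.foot_mk η hv]

end HasRadialProfile

/-! ### Existence of the Radon transform -/

theorem IteratedIntegrable.of_integrable_prod {X Y : Type*} [MeasurableSpace X]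
    [MeasurableSpace Y] {ν : Measure X} {μ : Measure Y} [SFinite ν] [SFinite μ] {F : X → Y → ℂ}
    (h : Integrable (Function.uncurry F) (ν.prod μ)) : IteratedIntegrable ν (fun _ => μ) F :=
  ⟨h.prod_right_ae, h.integral_norm_prod_left, h.1.integral_prod_right'⟩

theorem integrable_prod_pow_smul {X E : Type*} [MeasurableSpace X] [NormedAddCommGroup E]
    [NormedSpace ℝ E] {ν : Measure X} [SFinite ν] {F : X → ℝ → E} {a : ℝ} (ha : 0 ≤ a) (j : ℕ)
    (hF : AEStronglyMeasurable (Function.uncurry F) (ν.prod (volume.restrict (Ioi a))))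
    (h : ∫⁻ x, (∫⁻ r in Ioi a, ‖F x r‖ₑ * ENNReal.ofReal (r ^ j)) ∂ν < ∞) :
    Integrable (fun p => p.2 ^ j • F p.1 p.2) (ν.prod (volume.restrict (Ioi a))) := by
  have h_meas : AEStronglyMeasurable (fun p : X × ℝ => p.2 ^ j • F p.1 p.2)
      (ν.prod (volume.restrict (Ioi a))) :=
    (Measurable.aestronglyMeasurable (by fun_prop)).smul hF
  refine ⟨h_meas, ?_⟩
  rw [HasFiniteIntegral, lintegral_prod _ h_meas.enorm]
  refine (lintegral_congr fun x => setLIntegral_congr_fun measurableSet_Ioi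
    fun r hr => ?_).trans_lt h
  rw [enorm_smul, Real.enorm_of_nonneg (pow_nonneg (ha.trans (le_of_lt hr)) j), mul_comm]

section Existence

variable {V : Type*} [NormedAddCommGroup V] [InnerProductSpace ℝ V] [FiniteDimensional ℝ V]
  {k m : ℕ}

theorem ae_forall_integrable_subGrMeasure_prod_pow_smul {E : Type*} [NormedAddCommGroup E]
    [NormedSpace ℝ E] (hkm : k ≤ m) (hm : m ≤ Module.finrank ℝ V) {F : Gr V k × ℝ → E}
    (h : ∀ a > 0, Integrable F ((grMeasure V k).prod (volume.restrict (Ioi a)))) :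
    ∀ᵐ η ∂grMeasure V m, ∀ a > 0,
      Integrable F ((subGrMeasure k η).prod (volume.restrict (Ioi a))) := by
  have h_seq : ∀ᵐ η ∂grMeasure V m, ∀ j : ℕ,
      Integrable F ((subGrMeasure k η).prod (volume.restrict (Ioi (1 / ((j : ℝ) + 1))))) :=
    ae_all_iff.2 fun j => ae_integrable_subGrMeasure_prod hkm hm (h _ Nat.one_div_pos_of_nat)
  filter_upwards [h_seq] with η hη a ha
  obtain ⟨j, hj⟩ := exists_nat_one_div_lt ha
  exact (hη j).mono_measure
    (Measure.prod_mono le_rfl (Measure.restrict_mono_set _ (Ioi_subset_Ioi hj.le)))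

theorem ae_ae_iteratedIntegrable_radialIntegrand (hkm : k < m) (hm : m ≤ Module.finrank ℝ V)
    {f₀ : Gr V k → ℝ → ℂ}
    (hmeas : AEStronglyMeasurable (Function.uncurry f₀)
      ((grMeasure V k).prod (volume.restrict (Ioi (0 : ℝ)))))
    (hint : ∀ a : ℝ, 0 < a →
      ∫⁻ ξ, (∫⁻ r in Ioi a, ‖f₀ ξ r‖ₑ * ENNReal.ofReal (r ^ (m - k - 1))) ∂grMeasure V k < ∞) :
    ∀ᵐ η ∂grMeasure V m, ∀ᵐ s ∂volume.restrict (Ioi (0 : ℝ)),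
      IteratedIntegrable (subGrMeasure k η) (fun _ => volume.restrict (Ioi s))
        (radialIntegrand (m - k) f₀ s) := by
  have h_int : ∀ a > 0, Integrable (fun p : Gr V k × ℝ => p.2 ^ (m - k - 1) • f₀ p.1 p.2)
      ((grMeasure V k).prod (volume.restrict (Ioi a))) := fun a ha =>
    integrable_prod_pow_smul ha.le _ (hmeas.mono_measure
      (Measure.prod_mono le_rfl (Measure.restrict_mono_set _ (Ioi_subset_Ioi ha.le)))) (hint a ha)
  filter_upwards [ae_forall_integrable_subGrMeasure_prod_pow_smul hkm.le hm h_int] with η hη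
  refine ae_restrict_Ioi_of_forall_lt fun a ha => ?_
  filter_upwards [ae_integrable_abelKernel_smul (Nat.sub_ne_zero_of_lt hkm) ha _ (hη a ha)]
    with s hs
  refine .of_integrable_prod (hs.congr (.of_forall fun p => ?_))
  simp only [Function.uncurry, radialIntegrand_eq_smul]

theorem HasRadialProfile.ae_ae_radonExists [MeasurableSpace V] [BorelSpace V]
    {f : AffGr V k → ℂ} {f₀ : Gr V k → ℝ → ℂ} (hf : HasRadialProfile f f₀) (hkm : k < m)
    (hm : m < Module.finrank ℝ V)
    (hmeas : AEStronglyMeasurable (Function.uncurry f₀)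
      ((grMeasure V k).prod (volume.restrict (Ioi (0 : ℝ)))))
    (hint : ∀ a : ℝ, 0 < a →
      ∫⁻ ξ, (∫⁻ r in Ioi a, ‖f₀ ξ r‖ₑ * ENNReal.ofReal (r ^ (m - k - 1))) ∂grMeasure V k < ∞) :
    ∀ᵐ η ∂(grMeasure V m), ∀ᵐ v : ↥(Submodule.orthogonal η.1), RadonExists f (AffGr.mk η v.1) := by
  filter_upwards [ae_ae_iteratedIntegrable_radialIntegrand hkm hm.le hmeas hint] with η hη
  have := nontrivial_orthogonal hm η
  filter_upwards [ae_of_ae_map measurable_norm.aemeasurable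
    ((map_norm_absolutelyContinuous (volume : Measure ↥η.1ᗮ)).ae_le hη)] with v hv
  exact (hf.radonExists_mk_iff hkm η v.2).2 hv

theorem lemma3p2_general [MeasurableSpace V] [BorelSpace V] (hkm : k < m)
    (hm : m < Module.finrank ℝ V) (f : AffGr V k → ℂ) (f₀ : Gr V k → ℝ → ℂ)
    (hf : HasRadialProfile f f₀)
    (hmeas : AEStronglyMeasurable (Function.uncurry f₀)
      ((grMeasure V k).prod (volume.restrict (Ioi (0 : ℝ)))))
    (hint : ∀ a : ℝ, 0 < a →
      ∫⁻ ξ, (∫⁻ r in Ioi a, ‖f₀ ξ r‖ₑ * ENNReal.ofReal (r ^ (m - k - 1))) ∂grMeasure V k < ∞) :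
    (∀ᵐ η ∂(grMeasure V m), ∀ᵐ v : ↥(Submodule.orthogonal η.1), RadonExists f (AffGr.mk η v.1)) ∧
    QuasiRadial (radon m f) ∧
    (∀ φ₀ : Gr V m → ℝ → ℂ, HasRadialProfile (radon m f) φ₀ → ∀ (η : Gr V m) (s : ℝ), 0 ≤ s →
      φ₀ η s = ∫ ξ, radialTransform (m - k) f₀ s ξ ∂subGrMeasure k η) ∧
    (∀ (η : Gr V m), ∀ v ∈ η.1ᗮ, (RadonExists f (AffGr.mk η v) ↔
      IteratedIntegrable (subGrMeasure k η) (fun _ => volume.restrict (Ioi ‖v‖))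
        (radialIntegrand (m - k) f₀ ‖v‖))) :=
  ⟨hf.ae_ae_radonExists hkm hm hmeas hint, ⟨_, hf.radon hkm⟩,
    fun _ hφ₀ η _ hs => hφ₀.eq_of_nonneg (hf.radon hkm) hm η hs,
    fun η _ hv => hf.radonExists_mk_iff hkm η hv⟩

end Existence

theorem lemma3p2 {n k k' : ℕ} (hk : 1 ≤ k) (hkk' : k < k') (hk'n : k' < n)
    (f : AffGr (EuclideanSpace ℝ (Fin n)) k → ℂ)
    (f₀ : Gr (EuclideanSpace ℝ (Fin n)) k → ℝ → ℂ) (hf : HasRadialProfile f f₀)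
    (hmeas : AEStronglyMeasurable (Function.uncurry f₀)
      ((grMeasure (EuclideanSpace ℝ (Fin n)) k).prod (volume.restrict (Ioi (0 : ℝ)))))
    (hint : ∀ a : ℝ, 0 < a →
      ∫⁻ ξ, (∫⁻ r in Ioi a, ‖f₀ ξ r‖ₑ * ENNReal.ofReal (r ^ (k' - k - 1)))
        ∂(grMeasure (EuclideanSpace ℝ (Fin n)) k) < ∞) :
    -- the integral that defines the Radon transform exists for almost all planes
    (∀ᵐ η ∂(grMeasure (EuclideanSpace ℝ (Fin n)) k'),
      ∀ᵐ v : ↥(Submodule.orthogonal η.1), RadonExists f (AffGr.mk η v.1)) ∧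
    -- the Radon transform is quasi-radial
    QuasiRadial (radon k' f) ∧
    -- its radial profile is given by the explicit formula
    (∀ φ₀ : Gr (EuclideanSpace ℝ (Fin n)) k' → ℝ → ℂ, HasRadialProfile (radon k' f) φ₀ →
      ∀ (η : Gr (EuclideanSpace ℝ (Fin n)) k') (s : ℝ), 0 ≤ s →
        φ₀ η s = ∫ ξ, radialTransform (k' - k) f₀ s ξ ∂(subGrMeasure k η)) ∧
    -- the integrals on the two sides exist in the Lebesgue sense for the same planes
    (∀ (η : Gr (EuclideanSpace ℝ (Fin n)) k'), ∀ v ∈ Submodule.orthogonal η.1,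
      (RadonExists f (AffGr.mk η v) ↔
        IteratedIntegrable (subGrMeasure k η) (fun _ => volume.restrict (Ioi ‖v‖))
          (radialIntegrand (k' - k) f₀ ‖v‖))) :=
  lemma3p2_general hkk' (by simpa using hk'n) f f₀ hf hmeas hint
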